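/- Let $(U_i,V_i)_{i\in\mathbb Z}$ be a strictly stationary sequence of pairs of real random variables on a probability space, and let $(\alpha_i)_{i\in\mathbb N}$ be its strong mixing coefficients, $$\alpha_i=\sup_{k\in\mathbb Z}\ \sup\bigl\{|\mathbb P(A\cap B)-\mathbb P(A)\mathbb P(B)| : A\in\sigma((U_j,V_j),\,j\le k),\ B\in\sigma((U_j,V_j),\,j\ge k+i)\bigr\}.$$ Set $\widehat D_n=\frac1n\sum_{i=1}^n U_i$, $\widehat N_n=\frac1n\sum_{i=1}^n U_iV_i$, $D=\mathbb E U_1$ and $N=\mathbb E\,U_1V_1$. Let $2\le p<q$, $r=\frac{pq}{q-p}$, $s=\frac{p(q+2)}{q-p}$ and $r'>q$ be real numbers, and assume that for some constant $c$ $$\|U_0V_0\|_r\le c,\qquad \|V_0\|_s\le c,\qquad \|U_0\|_{r'}\le c .$$ If $\alpha_i=\mathcal O(i^{-\alpha})$ as $i\to\infty$ with $$\alpha>\left(\frac p2\cdot\frac r{r-p}\right)\vee\left(\frac q2\cdot\frac{r'}{r'-q}\right),$$ then there is a constant $C$ such that, for all $n\ge1$, $$\bigl\|\widehat D_n-D\bigr\|_q\le\frac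 C{\sqrt n}\qquad\text{and}\qquad \bigl\|\widehat N_n-N\bigr\|_p\le\frac C{\sqrt n}.$$ -/

import Mathlib

open MeasureTheory Filter Asymptotics

/-- Strict stationarity of a two-sided sequence: for every shift `h`, the sequence
`(W (i + h))_i` has the same law, on the product space `ℤ → E`, as `(W i)_i`. -/
def StrictlyStationary {Ω E : Type*} [MeasurableSpace Ω] [MeasurableSpace E]
    (μ : Measure Ω) (W : ℤ → Ω → E) : Prop :=
  ∀ h : ℤ, μ.map (fun ω (i : ℤ) => W (i + h) ω) = μ.map (fun ω (i : ℤ) => W i ω)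

/-- The σ-algebra generated by `W j`, `j ≤ k`. -/
@[reducible] def pastSigma {Ω E : Type*} [MeasurableSpace E] (W : ℤ → Ω → E) (k : ℤ) :
    MeasurableSpace Ω :=
  ⨆ j : ℤ, ⨆ _ : j ≤ k, MeasurableSpace.comap (W j) inferInstance

/-- The σ-algebra generated by `W j`, `j ≥ k`. -/
@[reducible] def futureSigma {Ω E : Type*} [MeasurableSpace E] (W : ℤ → Ω → E) (k : ℤ) :
    MeasurableSpace Ω :=
  ⨆ j : ℤ, ⨆ _ : k ≤ j, MeasurableSpace.comap (W j) inferInstance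

/-- The strong mixing coefficient of `W` at lag `i`: the supremum of
`|P(A ∩ B) - P(A) P(B)|` over all `k`, all `A` in the σ-algebra of `W j`, `j ≤ k`, and all `B` in
the σ-algebra of `W j`, `j ≥ k + i`. -/
noncomputable def strongMixingCoeff {Ω E : Type*} [MeasurableSpace Ω] [MeasurableSpace E]
    (μ : Measure Ω) (W : ℤ → Ω → E) (i : ℕ) : ℝ :=
  sSup {x : ℝ | ∃ (k : ℤ) (A B : Set Ω),
    MeasurableSet[pastSigma W k] A ∧ MeasurableSet[futureSigma W (k + (i : ℤ))] B ∧
      x = |μ.real (A ∩ B) - μ.real A * μ.real B|}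

/-- The empirical mean `(1 / n) ∑_{i=1}^n X i`. -/
noncomputable def empiricalMean {Ω : Type*} (X : ℤ → Ω → ℝ) (n : ℕ) (ω : Ω) : ℝ :=
  (1 / (n : ℝ)) * ∑ i ∈ Finset.Icc 1 n, X (i : ℤ) ω

/-! Both bounds are instances of one moment inequality for an instantaneous function of a stationary
mixing sequence, `exists_eLpNorm_empiricalMean_sub_integral_le`: the first coordinate with exponents
`(q, r')`, and the product of the coordinates with `(p, r)`.

For centred `X_i` with partial sums `S_n`, expand `|S_n + X_n|^p` to second order at `S_n`. The
quadratic remainder needs only Young's inequality. The linear term `φ'(S_n) X_n`, with `φ = |·|^p`,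
is telescoped into `(φ'(S_{j+1}) - φ'(S_j)) X_n`. The bracket depends only on the variables up to
`X_j` and has size `|X_j| M^(p-2)` in `L^a`, with `1/a = (p-2)/p + 1/r`, where `M` bounds the `L^p`
norms of the partial sums. Davydov's inequality `abs_integral_mul_le_of_mixing` then gains the
mixing bound at lag `n - j` to the power `1 - 1/a - 1/r = 2/p - 2/r`, summable exactly because `α >
(p/2) r/(r-p)`.

Hence `E|S_n|^p ≤ C n M^(p-2)` (`integral_abs_sum_rpow_le_mul`). Taking for `M` the largest norm up
to time `N` gives `M^2 ≤ C N`, the required `√N` growth. -/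

/-! ### Covariance inequalities under strong mixing -/

/-- Replace `g` by its conditional expectation `Z`. Since `{Z ≥ 0}` and `{Z ≤ 0}` lie in `m`, the
hypothesis on these two sets bounds the `L^1` norm of `Z` by `2δ`. -/
theorem abs_integral_mul_le_of_abs_setIntegral_le {Ω : Type*} {m m0 : MeasurableSpace Ω}
    (hm : m ≤ m0) {μ : Measure Ω} [IsFiniteMeasure μ] {X g : Ω → ℝ} {M δ : ℝ}
    (hM : 0 ≤ M) (hX : Measurable[m] X) (hXM : ∀ ω, |X ω| ≤ M) (hg : Integrable g μ)
    (h : ∀ A, MeasurableSet[m] A → |∫ ω in A, g ω ∂μ| ≤ δ) :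
    |∫ ω, X ω * g ω ∂μ| ≤ 2 * M * δ := by
  set Z := μ[g|m] with hZ
  have hZi : Integrable Z μ := integrable_condExp
  have hXg : Integrable (X * g) μ :=
    hg.bdd_mul (hX.mono hm le_rfl).aestronglyMeasurable (ae_of_all _ hXM)
  have hXZ : ∫ ω, X ω * g ω ∂μ = ∫ ω, X ω * Z ω ∂μ := by
    calc ∫ ω, X ω * g ω ∂μ = ∫ ω, (μ[X * g|m]) ω ∂μ := (integral_condExp hm).symm
      _ = ∫ ω, X ω * Z ω ∂μ :=
        integral_congr_ae (condExp_mul_of_stronglyMeasurable_left hX.stronglyMeasurable hXg hg)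
  have hset : ∀ A, MeasurableSet[m] A → |∫ ω in A, Z ω ∂μ| ≤ δ := fun A hA => by
    rw [setIntegral_condExp hm hg hA]
    exact h A hA
  have hZm : Measurable[m] Z := stronglyMeasurable_condExp.measurable
  have hpos := hset {ω | 0 ≤ Z ω} (measurableSet_le measurable_const hZm)
  have hneg := hset {ω | Z ω ≤ 0} (measurableSet_le hZm measurable_const)
  have habs : ∫ ω, |Z ω| ∂μ ≤ 2 * δ := by
    have := integral_norm_eq_pos_sub_neg hZi
    simp only [Real.norm_eq_abs] at this
    rw [this]
    linarith [abs_le.mp hpos, abs_le.mp hneg]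
  rw [hXZ]
  calc |∫ ω, X ω * Z ω ∂μ| ≤ ∫ ω, |X ω * Z ω| ∂μ := abs_integral_le_integral_abs
    _ ≤ ∫ ω, M * |Z ω| ∂μ := by
      refine integral_mono_of_nonneg (ae_of_all _ fun _ => abs_nonneg _)
        (hZi.abs.const_mul M) (ae_of_all _ fun ω => ?_)
      simp only [abs_mul]
      exact mul_le_mul_of_nonneg_right (hXM ω) (abs_nonneg _)
    _ ≤ 2 * M * δ := by
      rw [integral_const_mul]
      nlinarith [mul_le_mul_of_nonneg_left habs hM]

/-- The preceding lemma is used twice: `X` against a centred indicator of `B`, then `Y` against `X -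
E X`. Each use costs a factor 2. -/
theorem abs_covariance_le_of_bounded {Ω : Type*} {m₁ m₂ m0 : MeasurableSpace Ω}
    (hm₁ : m₁ ≤ m0) (hm₂ : m₂ ≤ m0) {μ : Measure Ω} [IsProbabilityMeasure μ]
    {X Y : Ω → ℝ} {M L δ : ℝ} (hX : Measurable[m₁] X) (hY : Measurable[m₂] Y)
    (hM : 0 ≤ M) (hL : 0 ≤ L) (hXM : ∀ ω, |X ω| ≤ M) (hYL : ∀ ω, |Y ω| ≤ L)
    (hmix : ∀ A B, MeasurableSet[m₁] A → MeasurableSet[m₂] B →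
      |μ.real (A ∩ B) - μ.real A * μ.real B| ≤ δ) :
    |∫ ω, X ω * Y ω ∂μ - (∫ ω, X ω ∂μ) * ∫ ω, Y ω ∂μ| ≤ 4 * M * L * δ := by
  have hXi : Integrable X μ :=
    Integrable.of_bound (hX.mono hm₁ le_rfl).aestronglyMeasurable M (ae_of_all _ hXM)
  have hYi : Integrable Y μ :=
    Integrable.of_bound (hY.mono hm₂ le_rfl).aestronglyMeasurable L (ae_of_all _ hYL)
  have hXY : Integrable (fun ω => X ω * Y ω) μ :=
    hYi.bdd_mul (hX.mono hm₁ le_rfl).aestronglyMeasurable (ae_of_all _ hXM)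
  have hB : ∀ B, MeasurableSet[m₂] B →
      |∫ ω in B, (X ω - ∫ ω', X ω' ∂μ) ∂μ| ≤ 2 * M * δ := by
    intro B hB
    have hBi : Integrable (B.indicator (fun _ => (1 : ℝ))) μ :=
      (integrable_const 1).indicator (hm₂ B hB)
    have key := abs_integral_mul_le_of_abs_setIntegral_le hm₁ (μ := μ) hM hX hXM
      (g := fun ω => B.indicator (fun _ => (1 : ℝ)) ω - μ.real B) (δ := δ)
      (hBi.sub (integrable_const _)) (fun A hA => by
        rw [integral_sub hBi.integrableOn (integrable_const _), setIntegral_indicator (hm₂ B hB)]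
        simpa using hmix A B hA hB)
    have hind : ∀ ω, X ω * B.indicator (fun _ => (1 : ℝ)) ω = B.indicator X ω := fun ω => by
      by_cases h : ω ∈ B <;> simp [h]
    have hrew : ∫ ω in B, (X ω - ∫ ω', X ω' ∂μ) ∂μ
        = ∫ ω, X ω * (B.indicator (fun _ => (1 : ℝ)) ω - μ.real B) ∂μ := by
      rw [integral_sub hXi.integrableOn (integrable_const _)]
      simp_rw [mul_sub, hind]
      rw [integral_sub (hXi.indicator (hm₂ B hB)) (hXi.mul_const _),
        integral_indicator (hm₂ B hB), integral_mul_const]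
      simp [mul_comm]
    rw [hrew]
    exact key
  have key := abs_integral_mul_le_of_abs_setIntegral_le hm₂ (μ := μ) hL hY hYL
    (hXi.sub (integrable_const (∫ ω', X ω' ∂μ))) hB
  have hrew : ∫ ω, X ω * Y ω ∂μ - (∫ ω, X ω ∂μ) * ∫ ω, Y ω ∂μ
      = ∫ ω, Y ω * (X ω - ∫ ω', X ω' ∂μ) ∂μ := by
    simp_rw [mul_sub]
    rw [integral_sub (by simpa only [mul_comm] using hXY) (hYi.mul_const _), integral_mul_const]
    simp_rw [mul_comm]
  rw [hrew]
  calc _ ≤ _ := key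
    _ = _ := by ring

/-- Weighted AM-GM, with the number 1 carrying the weight left over when `1/a + 1/b < 1`. -/
theorem mul_le_rpow_add_rpow_add_one {a b u v : ℝ} (ha : 0 < a) (hb : 0 < b)
    (hab : 1 / a + 1 / b ≤ 1) (hu : 0 ≤ u) (hv : 0 ≤ v) :
    u * v ≤ 1 / a * u ^ a + 1 / b * v ^ b + (1 - 1 / a - 1 / b) := by
  have h := Real.geom_mean_le_arith_mean3_weighted (w₁ := 1 / a) (w₂ := 1 / b)
    (w₃ := 1 - 1 / a - 1 / b) (by positivity) (by positivity) (by linarith)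
    (Real.rpow_nonneg hu a) (Real.rpow_nonneg hv b) zero_le_one (by ring)
  rw [← Real.rpow_mul hu, ← Real.rpow_mul hv, mul_one_div_cancel ha.ne',
    mul_one_div_cancel hb.ne'] at h
  simpa using h

theorem mul_le_rpow_add_rpow_of_one_lt {a b u v : ℝ} (ha : 0 < a) (hb : 0 < b)
    (hab : 1 / a + 1 / b ≤ 1) (hu : 0 ≤ u) (hv : 0 ≤ v) (h : 1 < u ∨ 1 < v) :
    u * v ≤ u ^ a + v ^ b := by
  have h1 := mul_le_rpow_add_rpow_add_one ha hb hab hu hv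
  have hua := Real.rpow_nonneg hu a
  have hvb := Real.rpow_nonneg hv b
  have h2 : 1 ≤ u ^ a + v ^ b := by
    rcases h with h | h
    · linarith [Real.one_le_rpow h.le ha.le]
    · linarith [Real.one_le_rpow h.le hb.le]
  have h3 : 0 < 1 / a := by positivity
  have h4 : 0 < 1 / b := by positivity
  nlinarith [mul_nonneg (sub_nonneg.2 hab) (sub_nonneg.2 h2), mul_nonneg h3.le hvb,
    mul_nonneg h4.le hua]

/-- Truncation changes the product only where `u` or `v` exceeds 1, and there Young's inequality
needs no additive constant. -/
theorem abs_mul_sub_truncation_mul_le {a b u v M L x y : ℝ} (ha : 0 < a) (hb : 0 < b)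
    (hab : 1 / a + 1 / b ≤ 1) (hM : 0 < M) (hL : 0 < L) (hu : u = |x| / M) (hv : v = |y| / L) :
    |x * y - (if |x| ≤ M then x else 0) * (if |y| ≤ L then y else 0)|
      ≤ M * L * (u ^ a + v ^ b) := by
  have hu0 : 0 ≤ u := by rw [hu]; positivity
  have hv0 : 0 ≤ v := by rw [hv]; positivity
  have hnn : 0 ≤ M * L * (u ^ a + v ^ b) := by positivity
  have hx : |x| = M * u := by rw [hu]; field_simp
  have hy : |y| = L * v := by rw [hv]; field_simp
  have key : (1 < u ∨ 1 < v) → |x * y| ≤ M * L * (u ^ a + v ^ b) := fun h => by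
    rw [abs_mul, hx, hy]
    have := mul_le_rpow_add_rpow_of_one_lt ha hb hab hu0 hv0 h
    nlinarith [mul_le_mul_of_nonneg_left this (mul_pos hM hL).le]
  by_cases h1 : |x| ≤ M
  · by_cases h2 : |y| ≤ L
    · simpa [h1, h2] using hnn
    · simpa [h2] using key (Or.inr (by rw [hv, one_lt_div hL]; exact not_le.1 h2))
  · simpa [h1] using key (Or.inl (by rw [hu, one_lt_div hM]; exact not_le.1 h1))

theorem abs_sub_truncation_le {b L y : ℝ} (hb : 1 ≤ b) (hL : 0 < L) :
    |y - (if |y| ≤ L then y else 0)| ≤ L * (|y| / L) ^ b := by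
  by_cases h : |y| ≤ L
  · simp only [h, if_true, sub_self, abs_zero]; positivity
  · simp only [h, if_false, sub_zero]
    have h1 : 1 ≤ |y| / L := by rw [one_le_div hL]; exact (not_le.1 h).le
    calc |y| = L * (|y| / L) := by field_simp
      _ ≤ L * (|y| / L) ^ b := by
        gcongr
        exact Real.self_le_rpow_of_one_le h1 hb

theorem integrable_mul_of_integrable_rpow {Ω : Type*} [MeasurableSpace Ω] {μ : Measure Ω}
    [IsFiniteMeasure μ] {X Y : Ω → ℝ} {a b κ l : ℝ} (hX : Measurable X) (hY : Measurable Y)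
    (ha : 0 < a) (hb : 0 < b) (hab : 1 / a + 1 / b ≤ 1) (hκ : 0 < κ) (hl : 0 < l)
    (hXa : Integrable (fun ω => (|X ω| / κ) ^ a) μ)
    (hYb : Integrable (fun ω => (|Y ω| / l) ^ b) μ) :
    Integrable (fun ω => X ω * Y ω) μ := by
  have hdom : Integrable (fun ω => κ * l * (1 / a * (|X ω| / κ) ^ a + 1 / b * (|Y ω| / l) ^ b
      + (1 - 1 / a - 1 / b))) μ :=
    (((hXa.const_mul _).add (hYb.const_mul _)).add (integrable_const _)).const_mul _
  refine hdom.mono' (hX.mul hY).aestronglyMeasurable (ae_of_all _ fun ω => ?_)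
  have h := mul_le_rpow_add_rpow_add_one ha hb hab (u := |X ω| / κ) (v := |Y ω| / l)
    (by positivity) (by positivity)
  rw [Real.norm_eq_abs, abs_mul]
  calc |X ω| * |Y ω| = κ * l * (|X ω| / κ * (|Y ω| / l)) := by field_simp
    _ ≤ _ := mul_le_mul_of_nonneg_left h (by positivity)

/-- Davydov's covariance inequality, for a centred second variable, with truncation levels. -/
theorem abs_integral_mul_le_of_truncation {Ω : Type*} {m₁ m₂ m0 : MeasurableSpace Ω}
    (hm₁ : m₁ ≤ m0) (hm₂ : m₂ ≤ m0) {μ : Measure Ω} [IsProbabilityMeasure μ]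
    {X Y : Ω → ℝ} {a b M L T δ : ℝ} (hX : Measurable[m₁] X) (hY : Measurable[m₂] Y)
    (ha : 1 ≤ a) (hb : 1 ≤ b) (hab : 1 / a + 1 / b ≤ 1) (hM : 0 < M) (hL : 0 < L)
    (hXa : Integrable (fun ω => (|X ω| / M) ^ a) μ)
    (hYb : Integrable (fun ω => (|Y ω| / L) ^ b) μ)
    (hXT : ∫ ω, (|X ω| / M) ^ a ∂μ ≤ T * δ) (hYT : ∫ ω, (|Y ω| / L) ^ b ∂μ ≤ T * δ)
    (hY0 : ∫ ω, Y ω ∂μ = 0)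
    (hmix : ∀ A B, MeasurableSet[m₁] A → MeasurableSet[m₂] B →
      |μ.real (A ∩ B) - μ.real A * μ.real B| ≤ δ) :
    |∫ ω, X ω * Y ω ∂μ| ≤ (4 + 3 * T) * (M * L * δ) := by
  have ha0 : 0 < a := by linarith
  have hb0 : 0 < b := by linarith
  have htm : ∀ N : ℝ, Measurable (fun x : ℝ => if |x| ≤ N then x else 0) := fun N =>
    Measurable.ite (measurableSet_le measurable_norm measurable_const) measurable_id
      measurable_const
  have htb : ∀ N : ℝ, 0 ≤ N → ∀ x : ℝ, |if |x| ≤ N then x else 0| ≤ N := fun N hN x => by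
    split_ifs with h
    · exact h
    · simpa using hN
  set X' : Ω → ℝ := fun ω => if |X ω| ≤ M then X ω else 0 with hX'
  set Y' : Ω → ℝ := fun ω => if |Y ω| ≤ L then Y ω else 0 with hY'
  have hX'm : Measurable[m₁] X' := (htm M).comp hX
  have hY'm : Measurable[m₂] Y' := (htm L).comp hY
  have hX'b : ∀ ω, |X' ω| ≤ M := fun ω => htb M hM.le _
  have hY'b : ∀ ω, |Y' ω| ≤ L := fun ω => htb L hL.le _
  have hX0 : Measurable X := hX.mono hm₁ le_rfl
  have hYm0 : Measurable Y := hY.mono hm₂ le_rfl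
  have hX'0 : Measurable X' := hX'm.mono hm₁ le_rfl
  have hY'0 : Measurable Y' := hY'm.mono hm₂ le_rfl
  have hX'i : Integrable X' μ :=
    Integrable.of_bound hX'0.aestronglyMeasurable M (ae_of_all _ hX'b)
  have hY'i : Integrable Y' μ :=
    Integrable.of_bound hY'0.aestronglyMeasurable L (ae_of_all _ hY'b)
  have hX'Y' : Integrable (fun ω => X' ω * Y' ω) μ :=
    hY'i.bdd_mul hX'0.aestronglyMeasurable (ae_of_all _ hX'b)
  have hXY : Integrable (fun ω => X ω * Y ω) μ :=
    integrable_mul_of_integrable_rpow hX0 hYm0 ha0 hb0 hab hM hL hXa hYb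
  have hsubi : Integrable (fun ω => Y ω - Y' ω) μ :=
    (hYb.const_mul L).mono' (hYm0.sub hY'0).aestronglyMeasurable
      (ae_of_all _ fun ω => abs_sub_truncation_le hb hL)
  have hYi : Integrable Y μ := by
    refine (hsubi.add hY'i).congr (ae_of_all _ fun ω => ?_)
    simp
  have h1 := abs_covariance_le_of_bounded hm₁ hm₂ hX'm hY'm hM.le hL.le hX'b hY'b hmix
  have h2 : |∫ ω, X ω * Y ω ∂μ - ∫ ω, X' ω * Y' ω ∂μ| ≤ M * L * (T * δ + T * δ) := by
    rw [← integral_sub hXY hX'Y']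
    calc _ ≤ ∫ ω, |X ω * Y ω - X' ω * Y' ω| ∂μ := abs_integral_le_integral_abs
      _ ≤ ∫ ω, M * L * ((|X ω| / M) ^ a + (|Y ω| / L) ^ b) ∂μ :=
        integral_mono (hXY.sub hX'Y').abs ((hXa.add hYb).const_mul _)
          fun ω => abs_mul_sub_truncation_mul_le ha0 hb0 hab hM hL rfl rfl
      _ ≤ _ := by
        rw [integral_const_mul, integral_add hXa hYb]
        gcongr
  -- Centring of `Y` enters here: the mean of `Y'` is minus that of the discarded part. The final
  -- constant is 4 for the bounded covariance, `2T` for the truncation error and `T` for this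
  -- product of means.
  have h3 : |∫ ω, Y' ω ∂μ| ≤ L * (T * δ) := by
    have : ∫ ω, Y' ω ∂μ = -∫ ω, (Y ω - Y' ω) ∂μ := by
      rw [integral_sub hYi hY'i, hY0]; ring
    rw [this, abs_neg]
    calc _ ≤ ∫ ω, |Y ω - Y' ω| ∂μ := abs_integral_le_integral_abs
      _ ≤ ∫ ω, L * (|Y ω| / L) ^ b ∂μ :=
        integral_mono hsubi.abs (hYb.const_mul _) fun ω => abs_sub_truncation_le hb hL
      _ ≤ _ := by
        rw [integral_const_mul]
        gcongr
  have h4 : |∫ ω, X' ω ∂μ| ≤ M := by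
    simpa using norm_integral_le_of_norm_le_const (μ := μ) (f := X') (ae_of_all _ hX'b)
  have h5 : |(∫ ω, X' ω ∂μ) * ∫ ω, Y' ω ∂μ| ≤ M * (L * (T * δ)) := by
    rw [abs_mul]
    exact mul_le_mul h4 h3 (abs_nonneg _) hM.le
  rw [abs_le] at *
  constructor <;> linarith [h1.1, h1.2, h2.1, h2.2, h5.1, h5.2]

/-- Davydov's covariance inequality, for a centred second variable. -/
theorem abs_integral_mul_le_of_mixing {Ω : Type*} {m₁ m₂ m0 : MeasurableSpace Ω}
    (hm₁ : m₁ ≤ m0) (hm₂ : m₂ ≤ m0) {μ : Measure Ω} [IsProbabilityMeasure μ]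
    {X Y : Ω → ℝ} {a b κ l T δ : ℝ} (hX : Measurable[m₁] X) (hY : Measurable[m₂] Y)
    (ha : 1 ≤ a) (hb : 1 ≤ b) (hab : 1 / a + 1 / b ≤ 1) (hκ : 0 < κ) (hl : 0 < l) (hδ : 0 < δ)
    (hXa : Integrable (fun ω => (|X ω| / κ) ^ a) μ)
    (hYb : Integrable (fun ω => (|Y ω| / l) ^ b) μ)
    (hXT : ∫ ω, (|X ω| / κ) ^ a ∂μ ≤ T) (hYT : ∫ ω, (|Y ω| / l) ^ b ∂μ ≤ T)
    (hY0 : ∫ ω, Y ω ∂μ = 0)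
    (hmix : ∀ A B, MeasurableSet[m₁] A → MeasurableSet[m₂] B →
      |μ.real (A ∩ B) - μ.real A * μ.real B| ≤ δ) :
    |∫ ω, X ω * Y ω ∂μ| ≤ (4 + 3 * T) * (κ * l * δ ^ (1 - 1 / a - 1 / b)) := by
  -- Truncating at `κ δ^(-1/a)` and `l δ^(-1/b)` scales both normalised moments by exactly `δ`,
  -- which balances the truncation error against the mixing term.
  have hscale : ∀ {a κ : ℝ}, 1 ≤ a → 0 < κ → ∀ x : ℝ,
      (|x| / (κ * δ ^ (-(1 / a)))) ^ a = δ * (|x| / κ) ^ a := fun {a κ} ha hκ x => by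
    have ha0 : a ≠ 0 := by linarith
    have : |x| / (κ * δ ^ (-(1 / a))) = δ ^ (1 / a) * (|x| / κ) := by
      rw [Real.rpow_neg hδ.le]; field_simp
    rw [this, Real.mul_rpow (by positivity) (by positivity), ← Real.rpow_mul hδ.le,
      one_div_mul_cancel ha0, Real.rpow_one]
  have key := abs_integral_mul_le_of_truncation hm₁ hm₂ (μ := μ) (M := κ * δ ^ (-(1 / a)))
    (L := l * δ ^ (-(1 / b))) (T := T) hX hY ha hb hab (by positivity) (by positivity)
    (by simp_rw [hscale ha hκ]; exact hXa.const_mul δ)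
    (by simp_rw [hscale hb hl]; exact hYb.const_mul δ)
    (by simp_rw [hscale ha hκ]; rw [integral_const_mul, mul_comm]; gcongr)
    (by simp_rw [hscale hb hl]; rw [integral_const_mul, mul_comm]; gcongr) hY0 hmix
  have hexp : δ ^ (1 - 1 / a - 1 / b) = δ ^ (-(1 / a)) * δ ^ (-(1 / b)) * δ := by
    rw [← Real.rpow_add hδ, ← Real.rpow_add_one hδ.ne']
    congr 1; ring
  rw [hexp]
  calc _ ≤ _ := key
    _ = _ := by ring

/-! ### Increments of `|x|^p` and of its derivative -/

/-- Bernoulli's inequality at `x/y` says that the convex function `t^(s+1)` lies above its tangent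
at `y`. -/
theorem rpow_add_one_sub_le {s x y : ℝ} (hs : 0 ≤ s) (hx : 0 ≤ x) (hxy : x ≤ y) :
    |y ^ s * y - x ^ s * x| ≤ (s + 1) * |y - x| * (x ^ s + y ^ s) := by
  rcases hx.eq_or_lt with rfl | hx
  · rcases hxy.eq_or_lt with rfl | hy
    · simp
    -- `0 ^ s` is 1 for `s = 0` and 0 otherwise; only its sign is needed.
    · have h0 : (0 : ℝ) ≤ 0 ^ s := Real.rpow_nonneg le_rfl s
      have h1 : 0 ≤ y ^ s := Real.rpow_nonneg hy.le s
      rw [mul_zero, sub_zero, sub_zero, abs_of_nonneg (by positivity), abs_of_nonneg hy.le]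
      nlinarith [mul_nonneg hs (mul_nonneg hy.le h1), mul_nonneg hs (mul_nonneg hy.le h0),
        mul_nonneg hy.le h0]
  have hy : 0 < y := hx.trans_le hxy
  have hmono : x ^ s ≤ y ^ s := Real.rpow_le_rpow hx.le hxy hs
  have hxs : 0 ≤ x ^ s := Real.rpow_nonneg hx.le s
  have hys : 0 < y ^ s := Real.rpow_pos_of_pos hy s
  have hb := one_add_mul_self_le_rpow_one_add (s := x / y - 1)
    (by have : 0 < x / y := by positivity
        linarith) (p := s + 1) (by linarith)
  rw [add_sub_cancel, Real.div_rpow hx.le hy.le, Real.rpow_add_one hx.ne',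
    Real.rpow_add_one hy.ne', le_div_iff₀ (by positivity)] at hb
  have h2 : (1 + (s + 1) * (x / y - 1)) * (y ^ s * y)
      = y ^ s * y + (s + 1) * (x - y) * y ^ s := by field_simp
  rw [h2] at hb
  have h3 : x ^ s * x ≤ y ^ s * y := mul_le_mul hmono hxy hx.le hys.le
  rw [abs_of_nonneg (by linarith), abs_of_nonneg (by linarith)]
  nlinarith [mul_nonneg (mul_nonneg (by linarith : 0 ≤ s + 1) (sub_nonneg.2 hxy)) hxs]

theorem abs_abs_rpow_mul_self_sub_le {s : ℝ} (hs : 0 ≤ s) (x y : ℝ) :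
    |(|y| ^ s * y - |x| ^ s * x)| ≤ (s + 1) * |y - x| * (|x| ^ s + |y| ^ s) := by
  have hnn : ∀ x y : ℝ, 0 ≤ x → 0 ≤ y →
      |(|y| ^ s * y - |x| ^ s * x)| ≤ (s + 1) * |y - x| * (|x| ^ s + |y| ^ s) := by
    intro x y hx hy
    rw [abs_of_nonneg hx, abs_of_nonneg hy]
    rcases le_total x y with h | h
    · exact rpow_add_one_sub_le hs hx h
    · rw [abs_sub_comm, abs_sub_comm y, add_comm (x ^ s)]
      exact rpow_add_one_sub_le hs hy h
  have hopp : ∀ x y : ℝ, x ≤ 0 → 0 ≤ y →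
      |(|y| ^ s * y - |x| ^ s * x)| ≤ (s + 1) * |y - x| * (|x| ^ s + |y| ^ s) := by
    intro x y hx hy
    have h1 : 0 ≤ |x| ^ s := by positivity
    have h2 : 0 ≤ |y| ^ s := by positivity
    rw [abs_of_nonneg (by nlinarith : 0 ≤ |y| ^ s * y - |x| ^ s * x),
      abs_of_nonneg (by linarith : 0 ≤ y - x)]
    nlinarith [mul_nonneg h1 hy, mul_nonneg h2 (neg_nonneg.2 hx),
      mul_nonneg hs (mul_nonneg (by linarith : 0 ≤ y - x) (add_nonneg h1 h2))]
  rcases le_total 0 x with hx | hx <;> rcases le_total 0 y with hy | hy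
  · exact hnn x y hx hy
  · have := hopp y x hy hx
    rwa [abs_sub_comm, abs_sub_comm x, add_comm (|y| ^ s)] at this
  · exact hopp x y hx hy
  · have := hnn (-x) (-y) (by linarith) (by linarith)
    simp only [abs_neg] at this
    rw [← abs_neg, ← abs_neg (y - x)]
    convert this using 2 <;> ring_nf

/-- The derivative of `x ↦ |x| ^ p`. -/
noncomputable def absRpowDeriv (p x : ℝ) : ℝ := p * (|x| ^ (p - 2) * x)

theorem measurable_absRpowDeriv (p : ℝ) : Measurable (absRpowDeriv p) := by
  unfold absRpowDeriv; fun_prop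

theorem absRpowDeriv_zero (p : ℝ) : absRpowDeriv p 0 = 0 := by simp [absRpowDeriv]

theorem abs_absRpowDeriv_sub_le {p : ℝ} (hp : 2 ≤ p) (x y : ℝ) :
    |absRpowDeriv p y - absRpowDeriv p x|
      ≤ p * (p - 1) * |y - x| * (|x| ^ (p - 2) + |y| ^ (p - 2)) := by
  have h := abs_abs_rpow_mul_self_sub_le (by linarith : 0 ≤ p - 2) x y
  rw [absRpowDeriv, absRpowDeriv, ← mul_sub, abs_mul, abs_of_nonneg (by linarith : 0 ≤ p)]
  calc _ ≤ p * ((p - 2 + 1) * |y - x| * (|x| ^ (p - 2) + |y| ^ (p - 2))) := by gcongr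
    _ = _ := by ring

/-- A mean value argument: the derivative at an intermediate point is compared with that at `x`. The
power `p - 2` of the intermediate point is at most the sum of those at the endpoints, whence the
factor 2. -/
theorem abs_rpow_sub_le {p : ℝ} (hp : 2 ≤ p) (x h : ℝ) :
    |x + h| ^ p - |x| ^ p ≤ absRpowDeriv p x * h
      + 2 * p * (p - 1) * (h ^ 2 * (|x| ^ (p - 2) + |x + h| ^ (p - 2))) := by
  have hpos : 0 ≤ p * (p - 1) := mul_nonneg (by linarith) (by linarith)
  have hderiv : ∀ t : ℝ, HasDerivAt (fun t => |x + t * h| ^ p)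
      (absRpowDeriv p (x + t * h) * h) t := fun t => by
    have h1 := hasDerivAt_abs_rpow (x + t * h) (by linarith : 1 < p)
    have h2 : HasDerivAt (fun t => x + t * h) h t := by
      simpa using ((hasDerivAt_id t).mul_const h).const_add x
    have h3 := h1.comp t h2
    rw [absRpowDeriv, ← mul_assoc]
    exact h3
  obtain ⟨t, ht, heq⟩ := exists_hasDerivAt_eq_slope (fun t => |x + t * h| ^ p) _ zero_lt_one
    (fun t _ => (hderiv t).continuousAt.continuousWithinAt) (fun t _ => hderiv t)
  simp only [one_mul, zero_mul, add_zero, sub_zero, div_one] at heq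
  rw [← heq]
  have hb := abs_absRpowDeriv_sub_le hp x (x + t * h)
  have hξ : |x + t * h| ^ (p - 2) ≤ |x| ^ (p - 2) + |x + h| ^ (p - 2) := by
    have hmax : |x + t * h| ≤ max |x| |x + h| := by
      have : x + t * h = (1 - t) * x + t * (x + h) := by ring
      rw [this]
      calc _ ≤ |(1 - t) * x| + |t * (x + h)| := abs_add_le _ _
        _ = (1 - t) * |x| + t * |x + h| := by
          rw [abs_mul, abs_mul, abs_of_nonneg ht.1.le, abs_of_nonneg (by linarith [ht.2])]
        _ ≤ (1 - t) * max |x| |x + h| + t * max |x| |x + h| := by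
          have := ht.1.le
          have : 0 ≤ 1 - t := by linarith [ht.2]
          gcongr
          · exact le_max_left _ _
          · exact le_max_right _ _
        _ = _ := by ring
    have hx0 : 0 ≤ |x| ^ (p - 2) := by positivity
    have hxh0 : 0 ≤ |x + h| ^ (p - 2) := by positivity
    rcases le_max_iff.1 hmax with hm | hm
    · linarith [Real.rpow_le_rpow (abs_nonneg _) hm (by linarith : 0 ≤ p - 2)]
    · linarith [Real.rpow_le_rpow (abs_nonneg _) hm (by linarith : 0 ≤ p - 2)]
  have hG : 0 ≤ |x + h| ^ (p - 2) := by positivity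
  have habs : |x + t * h - x| ≤ |h| := by
    rw [add_sub_cancel_left, abs_mul, abs_of_nonneg ht.1.le]
    nlinarith [abs_nonneg h, ht.2]
  have hdiff : absRpowDeriv p (x + t * h) * h - absRpowDeriv p x * h
      ≤ (p * (p - 1) * |h| * (2 * (|x| ^ (p - 2) + |x + h| ^ (p - 2)))) * |h| := by
    rw [← sub_mul]
    refine (le_abs_self _).trans ?_
    rw [abs_mul]
    refine mul_le_mul_of_nonneg_right (hb.trans ?_) (abs_nonneg _)
    gcongr
    linarith
  have hring : p * (p - 1) * |h| * (2 * (|x| ^ (p - 2) + |x + h| ^ (p - 2))) * |h|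
      = 2 * p * (p - 1) * (h ^ 2 * (|x| ^ (p - 2) + |x + h| ^ (p - 2))) := by
    rw [← sq_abs h]; ring
  linarith

theorem rpow_mul_sq_le {p s x : ℝ} (hp : 2 ≤ p) (hs : 0 ≤ s) (hx : 0 ≤ x) :
    s ^ (p - 2) * x ^ 2 ≤ s ^ p + x ^ p := by
  have hp0 : (0 : ℝ) < p := by linarith
  have hw : (p - 2) / p + 2 / p = 1 := by field_simp; ring
  have h1 : 0 ≤ (p - 2) / p := div_nonneg (by linarith) hp0.le
  have h2 : 0 ≤ 2 / p := by positivity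
  have h := Real.geom_mean_le_arith_mean2_weighted h1 h2
    (Real.rpow_nonneg hs p) (Real.rpow_nonneg hx p) hw
  rw [← Real.rpow_mul hs, ← Real.rpow_mul hx, mul_div_cancel₀ _ hp0.ne',
    mul_div_cancel₀ _ hp0.ne', Real.rpow_two] at h
  nlinarith [Real.rpow_nonneg hs p, Real.rpow_nonneg hx p]

/-- Normalised bound for the increments of `absRpowDeriv`. -/
theorem rpow_mul_rpow_max_le {a p r x s t : ℝ} (hp : 2 ≤ p) (hr : 0 < r) (ha : 0 < a)
    (ha' : 1 / a = (p - 2) / p + 1 / r) (hx : 0 ≤ x) (hs : 0 ≤ s) (ht : 0 ≤ t) :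
    (x * max s t ^ (p - 2)) ^ a ≤ x ^ r + (s ^ p + t ^ p) := by
  have hp0 : (0 : ℝ) < p := by linarith
  set m := max s t with hm
  have hm0 : 0 ≤ m := le_max_of_le_left hs
  have hmp : m ^ p ≤ s ^ p + t ^ p := by
    have h1 := Real.rpow_nonneg hs p
    have h2 := Real.rpow_nonneg ht p
    rcases max_choice s t with h | h <;> rw [hm, h] <;> linarith
  have hw : a / r + a * (p - 2) / p = 1 := by
    have : a * (1 / a) = 1 := mul_one_div_cancel ha.ne'
    rw [ha'] at this
    rw [← this]; ring
  have h2 : 0 ≤ a * (p - 2) / p := div_nonneg (mul_nonneg ha.le (by linarith)) hp0.le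
  have h1 : 0 ≤ a / r := by positivity
  have h := Real.geom_mean_le_arith_mean2_weighted h1 h2
    (Real.rpow_nonneg hx r) (Real.rpow_nonneg hm0 p) hw
  rw [← Real.rpow_mul hx, ← Real.rpow_mul hm0, mul_div_cancel₀ _ hr.ne',
    mul_div_cancel₀ _ hp0.ne'] at h
  rw [Real.mul_rpow hx (Real.rpow_nonneg hm0 _), ← Real.rpow_mul hm0, mul_comm (p - 2) a]
  nlinarith [Real.rpow_nonneg hx r, Real.rpow_nonneg hm0 p]

/-! ### Moments of partial sums -/

theorem integrable_div_rpow_of_memLp {Ω : Type*} [MeasurableSpace Ω] {μ : Measure Ω}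
    [IsFiniteMeasure μ] {f : Ω → ℝ} {p : ℝ} (hp : 0 < p) (hf : MemLp f (ENNReal.ofReal p) μ)
    {κ : ℝ} (hκ : 0 ≤ κ) : Integrable (fun ω => (|f ω| / κ) ^ p) μ := by
  have h := (hf.integrable_norm_rpow').div_const (κ ^ p)
  rw [ENNReal.toReal_ofReal hp.le] at h
  refine h.congr (ae_of_all _ fun ω => ?_)
  simp only [Real.norm_eq_abs]
  rw [Real.div_rpow (abs_nonneg _) hκ]

theorem integral_sq_mul_rpow_le {Ω : Type*} [MeasurableSpace Ω] {μ : Measure Ω}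
    {S ξ : Ω → ℝ} {p κ M : ℝ} (hS : Measurable S) (hξ : Measurable ξ) (hp : 2 ≤ p)
    (hκ : 0 < κ) (hM : 0 < M)
    (hSi : Integrable (fun ω => (|S ω| / M) ^ p) μ) (hS1 : ∫ ω, (|S ω| / M) ^ p ∂μ ≤ 1)
    (hξi : Integrable (fun ω => (|ξ ω| / κ) ^ p) μ) (hξ1 : ∫ ω, (|ξ ω| / κ) ^ p ∂μ ≤ 1) :
    Integrable (fun ω => ξ ω ^ 2 * |S ω| ^ (p - 2)) μ ∧
      ∫ ω, ξ ω ^ 2 * |S ω| ^ (p - 2) ∂μ ≤ 2 * (κ ^ 2 * M ^ (p - 2)) := by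
  have hpt : ∀ ω, ξ ω ^ 2 * |S ω| ^ (p - 2)
      ≤ κ ^ 2 * M ^ (p - 2) * ((|S ω| / M) ^ p + (|ξ ω| / κ) ^ p) := fun ω => by
    have h := rpow_mul_sq_le hp (s := |S ω| / M) (x := |ξ ω| / κ) (by positivity) (by positivity)
    have hMp : 0 < M ^ (p - 2) := Real.rpow_pos_of_pos hM _
    calc ξ ω ^ 2 * |S ω| ^ (p - 2)
        = κ ^ 2 * M ^ (p - 2) * ((|S ω| / M) ^ (p - 2) * (|ξ ω| / κ) ^ 2) := by
          rw [Real.div_rpow (abs_nonneg _) hM.le, div_pow, sq_abs]; field_simp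
      _ ≤ _ := mul_le_mul_of_nonneg_left h (by positivity)
  have hdom := (hSi.add hξi).const_mul (κ ^ 2 * M ^ (p - 2))
  have hint : Integrable (fun ω => ξ ω ^ 2 * |S ω| ^ (p - 2)) μ := by
    refine hdom.mono' (by fun_prop) (ae_of_all _ fun ω => ?_)
    rw [Real.norm_of_nonneg (by positivity)]
    exact hpt ω
  refine ⟨hint, (integral_mono hint hdom hpt).trans ?_⟩
  simp only [Pi.add_apply]
  rw [integral_const_mul, integral_add hSi hξi, mul_comm 2]
  gcongr
  linarith

/-- Davydov's inequality for one telescoping increment. The increment, divided by `K`, has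
`1/e`-moment at most 3, so the constant is `(4 + 3·3)·2 = 26`, the 2 coming from `K`. -/
theorem abs_integral_absRpowDeriv_sub_mul_le {Ω : Type*} {m₁ m₂ m0 : MeasurableSpace Ω}
    (hm₁ : m₁ ≤ m0) (hm₂ : m₂ ≤ m0) {μ : Measure Ω} [IsProbabilityMeasure μ]
    {S ξ Y : Ω → ℝ} {p r κ M δ : ℝ} (hS : Measurable[m₁] S) (hξ : Measurable[m₁] ξ)
    (hY : Measurable[m₂] Y) (hp : 2 ≤ p) (hpr : p < r) (hκ : 0 < κ) (hM : 0 < M) (hδ : 0 < δ)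
    (hSi : Integrable (fun ω => (|S ω| / M) ^ p) μ) (hS1 : ∫ ω, (|S ω| / M) ^ p ∂μ ≤ 1)
    (hTi : Integrable (fun ω => (|S ω + ξ ω| / M) ^ p) μ)
    (hT1 : ∫ ω, (|S ω + ξ ω| / M) ^ p ∂μ ≤ 1)
    (hξi : Integrable (fun ω => (|ξ ω| / κ) ^ r) μ) (hξ1 : ∫ ω, (|ξ ω| / κ) ^ r ∂μ ≤ 1)
    (hYi : Integrable (fun ω => (|Y ω| / κ) ^ r) μ) (hY1 : ∫ ω, (|Y ω| / κ) ^ r ∂μ ≤ 1)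
    (hY0 : ∫ ω, Y ω ∂μ = 0)
    (hmix : ∀ A B, MeasurableSet[m₁] A → MeasurableSet[m₂] B →
      |μ.real (A ∩ B) - μ.real A * μ.real B| ≤ δ) :
    Integrable (fun ω => (absRpowDeriv p (S ω + ξ ω) - absRpowDeriv p (S ω)) * Y ω) μ ∧
      |∫ ω, (absRpowDeriv p (S ω + ξ ω) - absRpowDeriv p (S ω)) * Y ω ∂μ|
        ≤ 26 * p * (p - 1) * (κ ^ 2 * M ^ (p - 2)) * δ ^ (2 / p - 2 / r) := by
  have hp0 : (0 : ℝ) < p := by linarith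
  have hr0 : 0 < r := by linarith
  set K := 2 * p * (p - 1) * κ * M ^ (p - 2) with hK
  have hK0 : 0 < K := by
    have : 0 < p - 1 := by linarith
    positivity
  set e := (p - 2) / p + 1 / r with he
  have hrp : 1 / r < 1 / p := one_div_lt_one_div_of_lt hp0 hpr
  have he_eq : e = 1 - 2 / p + 1 / r := by rw [he]; field_simp
  have hpp : 2 / p = 2 * (1 / p) := by ring
  have hrr : 2 / r = 2 * (1 / r) := by ring
  have he0 : 0 < e := by
    have : 0 ≤ (p - 2) / p := div_nonneg (by linarith) hp0.le
    have : 0 < 1 / r := by positivity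
    linarith
  have hp1 : 0 < 1 / p := by positivity
  have ha0 : 0 < 1 / e := by positivity
  have ha1 : 1 ≤ 1 / e := by rw [one_le_div he0]; linarith
  have hae : 1 / (1 / e) = e := one_div_one_div e
  have hab : 1 / (1 / e) + 1 / r ≤ 1 := by rw [hae]; linarith
  have hD : Measurable[m₁] fun ω => absRpowDeriv p (S ω + ξ ω) - absRpowDeriv p (S ω) :=
    ((measurable_absRpowDeriv p).comp (hS.add hξ)).sub ((measurable_absRpowDeriv p).comp hS)
  have hD0 := hD.mono hm₁ le_rfl
  have hpt : ∀ ω, (|absRpowDeriv p (S ω + ξ ω) - absRpowDeriv p (S ω)| / K) ^ (1 / e)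
      ≤ (|ξ ω| / κ) ^ r + ((|S ω| / M) ^ p + (|S ω + ξ ω| / M) ^ p) := fun ω => by
    refine le_trans (Real.rpow_le_rpow (by positivity) ?_ ha0.le)
      (rpow_mul_rpow_max_le hp hr0 ha0 hae (x := |ξ ω| / κ) (by positivity)
        (s := |S ω| / M) (by positivity) (t := |S ω + ξ ω| / M) (by positivity))
    have h := abs_absRpowDeriv_sub_le hp (S ω) (S ω + ξ ω)
    rw [add_sub_cancel_left] at h
    have hMp : 0 < M ^ (p - 2) := Real.rpow_pos_of_pos hM _
    have hms : |S ω| ^ (p - 2) ≤ M ^ (p - 2) * max (|S ω| / M) (|S ω + ξ ω| / M) ^ (p - 2) := by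
      rw [← Real.mul_rpow hM.le (by positivity)]
      refine Real.rpow_le_rpow (abs_nonneg _) ?_ (by linarith)
      rw [← div_le_iff₀' hM]
      exact le_max_left _ _
    have hmt : |S ω + ξ ω| ^ (p - 2)
        ≤ M ^ (p - 2) * max (|S ω| / M) (|S ω + ξ ω| / M) ^ (p - 2) := by
      rw [← Real.mul_rpow hM.le (by positivity)]
      refine Real.rpow_le_rpow (abs_nonneg _) ?_ (by linarith)
      rw [← div_le_iff₀' hM]
      exact le_max_right _ _
    have hpp1 : 0 ≤ p * (p - 1) := mul_nonneg hp0.le (by linarith)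
    rw [div_le_iff₀ hK0]
    calc _ ≤ _ := h
      _ ≤ p * (p - 1) * |ξ ω|
          * (2 * (M ^ (p - 2) * max (|S ω| / M) (|S ω + ξ ω| / M) ^ (p - 2))) := by
        gcongr; linarith
      _ = _ := by rw [hK]; field_simp
  have hST : Integrable (fun ω => (|S ω| / M) ^ p + (|S ω + ξ ω| / M) ^ p) μ := hSi.add hTi
  have hdom : Integrable
      (fun ω => (|ξ ω| / κ) ^ r + ((|S ω| / M) ^ p + (|S ω + ξ ω| / M) ^ p)) μ := hξi.add hST
  have hDi : Integrable (fun ω =>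
      (|absRpowDeriv p (S ω + ξ ω) - absRpowDeriv p (S ω)| / K) ^ (1 / e)) μ := by
    refine hdom.mono' ((hD0.abs.div_const K).pow_const _).aestronglyMeasurable
      (ae_of_all _ fun ω => ?_)
    rw [Real.norm_of_nonneg (by positivity)]
    exact hpt ω
  have hD3 : ∫ ω, (|absRpowDeriv p (S ω + ξ ω) - absRpowDeriv p (S ω)| / K) ^ (1 / e) ∂μ ≤ 3 := by
    refine (integral_mono hDi hdom hpt).trans ?_
    rw [integral_add hξi hST, integral_add hSi hTi]
    linarith
  refine ⟨integrable_mul_of_integrable_rpow hD0 (hY.mono hm₂ le_rfl) ha0 hr0 hab hK0 hκ hDi hYi,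
    ?_⟩
  have key := abs_integral_mul_le_of_mixing hm₁ hm₂ hD hY ha1 (by linarith) hab hK0 hκ hδ hDi hYi
    hD3 (hY1.trans (by norm_num)) hY0 hmix
  have hexp : 1 - 1 / (1 / e) - 1 / r = 2 / p - 2 / r := by rw [hae, he_eq]; ring
  rw [hexp] at key
  calc _ ≤ _ := key
    _ = _ := by rw [hK]; ring

/-- One step of the recursive moment bound for partial sums. -/
theorem integral_abs_sum_rpow_le_mul {Ω : Type*} [m0 : MeasurableSpace Ω] {μ : Measure Ω}
    [IsProbabilityMeasure μ] {X : ℕ → Ω → ℝ} {ℱ 𝒢 : ℕ → MeasurableSpace Ω} {p r κ M : ℝ}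
    {δ : ℕ → ℝ} (hp : 2 ≤ p) (hpr : p < r) (hκ : 0 < κ) (hM : 0 < M) (hδ : ∀ k, 0 < δ k)
    (hℱ : ∀ i, ℱ i ≤ m0) (h𝒢 : ∀ i, 𝒢 i ≤ m0)
    (hXℱ : ∀ i j, i ≤ j → Measurable[ℱ j] (X i)) (hX𝒢 : ∀ i, Measurable[𝒢 i] (X i))
    (hmix : ∀ i k A B, MeasurableSet[ℱ i] A → MeasurableSet[𝒢 (i + k + 1)] B →
      |μ.real (A ∩ B) - μ.real A * μ.real B| ≤ δ k)
    (hsum : Summable fun k => δ k ^ (2 / p - 2 / r))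
    (hXr : ∀ i, MemLp (X i) (ENNReal.ofReal r) μ) (hX0 : ∀ i, ∫ ω, X i ω ∂μ = 0)
    (hXκr : ∀ i, ∫ ω, (|X i ω| / κ) ^ r ∂μ ≤ 1) (hXκp : ∀ i, ∫ ω, (|X i ω| / κ) ^ p ∂μ ≤ 1)
    {N : ℕ} (hSM : ∀ n ≤ N, ∫ ω, (|∑ i ∈ Finset.range n, X i ω| / M) ^ p ∂μ ≤ 1)
    {n : ℕ} (hn : n ≤ N) :
    ∫ ω, |∑ i ∈ Finset.range n, X i ω| ^ p ∂μ
      ≤ n * (p * (p - 1) * κ ^ 2 * (26 * (∑' k, δ k ^ (2 / p - 2 / r)) + 8) * M ^ (p - 2)) := by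
  have hp0 : (0 : ℝ) < p := by linarith
  have hr0 : 0 < r := by linarith
  have hXp : ∀ i, MemLp (X i) (ENNReal.ofReal p) μ := fun i =>
    (hXr i).mono_exponent (ENNReal.ofReal_le_ofReal hpr.le)
  set S : ℕ → Ω → ℝ := fun n ω => ∑ i ∈ Finset.range n, X i ω with hS
  have hSp : ∀ n, MemLp (S n) (ENNReal.ofReal p) μ := fun n =>
    memLp_finsetSum _ fun i _ => hXp i
  have hSsucc : ∀ n ω, S (n + 1) ω = S n ω + X n ω := fun n ω => Finset.sum_range_succ _ _
  have hXm : ∀ i, Measurable (X i) := fun i => (hX𝒢 i).mono (h𝒢 i) le_rfl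
  have hSℱ : ∀ n, Measurable[ℱ n] (S n) := fun n =>
    Finset.measurable_fun_sum _ fun i hi => hXℱ i n (Finset.mem_range.1 hi).le
  have hSm : ∀ n, Measurable (S n) := fun n => (hSℱ n).mono (hℱ n) le_rfl
  have hSi : ∀ n, Integrable (fun ω => (|S n ω| / M) ^ p) μ := fun n =>
    integrable_div_rpow_of_memLp hp0 (hSp n) hM.le
  have hSa : ∀ n, Integrable (fun ω => |S n ω| ^ p) μ := fun n => by
    simpa using integrable_div_rpow_of_memLp hp0 (hSp n) zero_le_one
  have hXri : ∀ n, Integrable (fun ω => (|X n ω| / κ) ^ r) μ := fun n =>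
    integrable_div_rpow_of_memLp hr0 (hXr n) hκ.le
  have hXpi : ∀ n, Integrable (fun ω => (|X n ω| / κ) ^ p) μ := fun n =>
    integrable_div_rpow_of_memLp hp0 (hXp n) hκ.le
  have hpp1 : 0 ≤ p * (p - 1) := mul_nonneg hp0.le (by linarith)
  induction n with
  | zero => simp [Real.zero_rpow hp0.ne']
  | succ n ih =>
    have ih := ih (by omega)
    have hinc : ∀ j < n,
        Integrable (fun ω => (absRpowDeriv p (S j ω + X j ω) - absRpowDeriv p (S j ω)) * X n ω) μ ∧
        |∫ ω, (absRpowDeriv p (S j ω + X j ω) - absRpowDeriv p (S j ω)) * X n ω ∂μ|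
          ≤ 26 * p * (p - 1) * (κ ^ 2 * M ^ (p - 2)) * δ (n - 1 - j) ^ (2 / p - 2 / r) := by
      intro j hj
      -- The bracket uses `X 0, …, X j`, so its gap to `X n` is `n - j`; `δ k` stands for the gap `k
      -- + 1`.
      have hlag : j + (n - 1 - j) + 1 = n := by omega
      refine abs_integral_absRpowDeriv_sub_mul_le (hℱ j) (h𝒢 n) (hSℱ j) (hXℱ j j le_rfl) (hX𝒢 n)
        hp hpr hκ hM (hδ _) (hSi j) (hSM j (by omega)) ?_ ?_ (hXri j) (hXκr j) (hXri n) (hXκr n)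
        (hX0 n) fun A B hA hB => hmix j _ A B hA (by rwa [hlag])
      · simpa only [hSsucc] using hSi (j + 1)
      · simpa only [← hSsucc] using hSM (j + 1) (by omega)
    have htel : ∀ ω, absRpowDeriv p (S n ω) * X n ω = ∑ j ∈ Finset.range n,
        (absRpowDeriv p (S j ω + X j ω) - absRpowDeriv p (S j ω)) * X n ω := fun ω => by
      rw [← Finset.sum_mul]
      simp_rw [← hSsucc]
      rw [Finset.sum_range_sub (fun j => absRpowDeriv p (S j ω))]
      simp [hS, absRpowDeriv_zero]
    have hlin : Integrable (fun ω => absRpowDeriv p (S n ω) * X n ω) μ := by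
      simp_rw [htel]
      exact integrable_finsetSum _ fun j hj => (hinc j (Finset.mem_range.1 hj)).1
    have hlin_le : ∫ ω, absRpowDeriv p (S n ω) * X n ω ∂μ
        ≤ 26 * p * (p - 1) * (κ ^ 2 * M ^ (p - 2)) * ∑' k, δ k ^ (2 / p - 2 / r) := by
      simp_rw [htel]
      rw [integral_finsetSum _ fun j hj => (hinc j (Finset.mem_range.1 hj)).1]
      calc _ ≤ ∑ j ∈ Finset.range n, 26 * p * (p - 1) * (κ ^ 2 * M ^ (p - 2))
            * δ (n - 1 - j) ^ (2 / p - 2 / r) :=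
          Finset.sum_le_sum fun j hj =>
            (le_abs_self _).trans (hinc j (Finset.mem_range.1 hj)).2
        _ = 26 * p * (p - 1) * (κ ^ 2 * M ^ (p - 2))
            * ∑ k ∈ Finset.range n, δ k ^ (2 / p - 2 / r) := by
          rw [← Finset.mul_sum, Finset.sum_range_reflect (fun k => δ k ^ (2 / p - 2 / r))]
        _ ≤ _ := by
          refine mul_le_mul_of_nonneg_left
            (hsum.sum_le_tsum _ fun k _ => Real.rpow_nonneg (hδ k).le _) ?_
          have : 0 ≤ M ^ (p - 2) := by positivity
          nlinarith [mul_nonneg hpp1 (mul_nonneg (sq_nonneg κ) this)]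
    -- The two endpoint terms each give `2 κ^2 M^(p-2)`; with the Taylor factor `2p(p-1)` this is
    -- the 8 in the constant.
    have hq1 := integral_sq_mul_rpow_le (hSm n) (hXm n) hp hκ hM (hSi n) (hSM n (by omega))
      (hXpi n) (hXκp n)
    have hq2 := integral_sq_mul_rpow_le (hSm (n + 1)) (hXm n) hp hκ hM (hSi (n + 1)) (hSM _ hn)
      (hXpi n) (hXκp n)
    have hquad : Integrable (fun ω => 2 * p * (p - 1) * (X n ω ^ 2 * |S n ω| ^ (p - 2)
        + X n ω ^ 2 * |S (n + 1) ω| ^ (p - 2))) μ := (hq1.1.add hq2.1).const_mul _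
    have hlq : Integrable (fun ω => absRpowDeriv p (S n ω) * X n ω
        + 2 * p * (p - 1) * (X n ω ^ 2 * |S n ω| ^ (p - 2)
          + X n ω ^ 2 * |S (n + 1) ω| ^ (p - 2))) μ := hlin.add hquad
    have hstep : ∫ ω, |S (n + 1) ω| ^ p ∂μ ≤ ∫ ω, (|S n ω| ^ p + (absRpowDeriv p (S n ω) * X n ω
        + 2 * p * (p - 1) * (X n ω ^ 2 * |S n ω| ^ (p - 2)
          + X n ω ^ 2 * |S (n + 1) ω| ^ (p - 2)))) ∂μ := by
      refine integral_mono (hSa _) ((hSa n).add hlq) fun ω => ?_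
      have h := abs_rpow_sub_le hp (S n ω) (X n ω)
      rw [← hSsucc] at h
      simp only [← mul_add]
      linarith
    have heval : ∫ ω, (|S n ω| ^ p + (absRpowDeriv p (S n ω) * X n ω
        + 2 * p * (p - 1) * (X n ω ^ 2 * |S n ω| ^ (p - 2)
          + X n ω ^ 2 * |S (n + 1) ω| ^ (p - 2)))) ∂μ
        = ∫ ω, |S n ω| ^ p ∂μ + (∫ ω, absRpowDeriv p (S n ω) * X n ω ∂μ
          + 2 * p * (p - 1) * (∫ ω, X n ω ^ 2 * |S n ω| ^ (p - 2) ∂μ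
            + ∫ ω, X n ω ^ 2 * |S (n + 1) ω| ^ (p - 2) ∂μ)) := by
      rw [integral_add (hSa n) hlq, integral_add hlin hquad, integral_const_mul,
        integral_add hq1.1 hq2.1]
    rw [heval] at hstep
    have hquad_le := mul_le_mul_of_nonneg_left (add_le_add hq1.2 hq2.2)
      (by linarith : 0 ≤ 2 * (p * (p - 1)))
    push_cast
    linarith

/-- Marcinkiewicz–Zygmund type moment bound for partial sums of a centred sequence with summable
(powers of) strong mixing bounds. -/
theorem exists_integral_abs_sum_rpow_le {Ω : Type*} [m0 : MeasurableSpace Ω] {μ : Measure Ω}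
    [IsProbabilityMeasure μ] {X : ℕ → Ω → ℝ} {ℱ 𝒢 : ℕ → MeasurableSpace Ω} {p r κ : ℝ}
    {δ : ℕ → ℝ} (hp : 2 ≤ p) (hpr : p < r) (hκ : 0 < κ) (hδ : ∀ k, 0 < δ k)
    (hℱ : ∀ i, ℱ i ≤ m0) (h𝒢 : ∀ i, 𝒢 i ≤ m0)
    (hXℱ : ∀ i j, i ≤ j → Measurable[ℱ j] (X i)) (hX𝒢 : ∀ i, Measurable[𝒢 i] (X i))
    (hmix : ∀ i k A B, MeasurableSet[ℱ i] A → MeasurableSet[𝒢 (i + k + 1)] B →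
      |μ.real (A ∩ B) - μ.real A * μ.real B| ≤ δ k)
    (hsum : Summable fun k => δ k ^ (2 / p - 2 / r))
    (hXr : ∀ i, MemLp (X i) (ENNReal.ofReal r) μ) (hX0 : ∀ i, ∫ ω, X i ω ∂μ = 0)
    (hXκr : ∀ i, ∫ ω, (|X i ω| / κ) ^ r ∂μ ≤ 1) (hXκp : ∀ i, ∫ ω, (|X i ω| / κ) ^ p ∂μ ≤ 1) :
    ∃ C : ℝ, 0 ≤ C ∧ ∀ n : ℕ, ∫ ω, |∑ i ∈ Finset.range n, X i ω| ^ p ∂μ ≤ (C * n) ^ (p / 2) := by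
  have hp0 : (0 : ℝ) < p := by linarith
  have hpp1 : 0 ≤ p * (p - 1) := mul_nonneg hp0.le (by linarith)
  have hts : 0 ≤ ∑' k, δ k ^ (2 / p - 2 / r) := tsum_nonneg fun k => Real.rpow_nonneg (hδ k).le _
  set C := p * (p - 1) * κ ^ 2 * (26 * (∑' k, δ k ^ (2 / p - 2 / r)) + 8) with hC
  have hC0 : 0 ≤ C := by positivity
  refine ⟨C, hC0, fun N => ?_⟩
  set I : ℕ → ℝ := fun n => ∫ ω, |∑ i ∈ Finset.range n, X i ω| ^ p ∂μ with hI
  have hI0 : ∀ n, 0 ≤ I n := fun n => integral_nonneg fun ω => by positivity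
  -- Working at the maximising time makes `M` both the uniform bound and the quantity being
  -- estimated, so the recursion closes.
  obtain ⟨n, hn, hmax⟩ := (Finset.range (N + 1)).exists_max_image I ⟨0, by simp⟩
  have hn : n ≤ N := by simpa [Nat.lt_succ_iff] using hn
  have hmax : ∀ j ≤ N, I j ≤ I n := fun j hj => hmax j (by simpa [Nat.lt_succ_iff] using hj)
  change I N ≤ _
  refine (hmax N le_rfl).trans ?_
  rcases (hI0 n).eq_or_lt with h0 | hpos
  · rw [← h0]; positivity
  set M := I n ^ (1 / p) with hM
  have hM0 : 0 < M := Real.rpow_pos_of_pos hpos _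
  have hMp : M ^ p = I n := by
    rw [hM, ← Real.rpow_mul hpos.le, one_div_mul_cancel hp0.ne', Real.rpow_one]
  have hSM : ∀ j ≤ N, ∫ ω, (|∑ i ∈ Finset.range j, X i ω| / M) ^ p ∂μ ≤ 1 := fun j hj => by
    simp_rw [Real.div_rpow (abs_nonneg _) hM0.le]
    rw [integral_div, hMp, div_le_one hpos]
    exact hmax j hj
  have key := integral_abs_sum_rpow_le_mul hp hpr hκ hM0 hδ hℱ h𝒢 hXℱ hX𝒢 hmix hsum hXr hX0 hXκr
    hXκp hSM hn
  change I n ≤ _ at key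
  have hsplit : M ^ p = M ^ 2 * M ^ (p - 2) := by
    rw [← Real.rpow_two, ← Real.rpow_add hM0]; congr 1; ring
  rw [← hC, ← hMp, hsplit, ← mul_assoc] at key
  have hM2 : M ^ 2 ≤ C * N := by
    have h1 := le_of_mul_le_mul_right key (Real.rpow_pos_of_pos hM0 _)
    have h2 : (n : ℝ) ≤ N := by exact_mod_cast hn
    nlinarith
  calc I n = (M ^ 2) ^ (p / 2) := by
        rw [← hMp, ← Real.rpow_two, ← Real.rpow_mul hM0.le]; congr 1; ring
    _ ≤ _ := Real.rpow_le_rpow (by positivity) hM2 (by positivity)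

/-! ### Stationary sequences and their mixing coefficients -/

theorem StrictlyStationary.map_eq {Ω E : Type*} [MeasurableSpace Ω] [MeasurableSpace E]
    {μ : Measure Ω} {W : ℤ → Ω → E} (hW : ∀ i, Measurable (W i)) (h : StrictlyStationary μ W)
    (i : ℤ) : μ.map (W i) = μ.map (W 0) := by
  have key := congrArg (fun ν : Measure (ℤ → E) => ν.map fun w => w 0) (h i)
  rw [Measure.map_map (measurable_pi_apply 0) (measurable_pi_lambda _ fun j => hW _),
    Measure.map_map (measurable_pi_apply 0) (measurable_pi_lambda _ fun j => hW _)] at key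
  simpa [Function.comp_def] using key

theorem pastSigma_le {Ω E : Type*} [mΩ : MeasurableSpace Ω] [MeasurableSpace E] {W : ℤ → Ω → E}
    (hW : ∀ i, Measurable (W i)) (k : ℤ) : pastSigma W k ≤ mΩ :=
  iSup₂_le fun j _ => (hW j).comap_le

theorem futureSigma_le {Ω E : Type*} [mΩ : MeasurableSpace Ω] [MeasurableSpace E]
    {W : ℤ → Ω → E} (hW : ∀ i, Measurable (W i)) (k : ℤ) : futureSigma W k ≤ mΩ :=
  iSup₂_le fun j _ => (hW j).comap_le

theorem measurable_pastSigma {Ω E : Type*} [MeasurableSpace E] (W : ℤ → Ω → E) {j k : ℤ}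
    (h : j ≤ k) : Measurable[pastSigma W k] (W j) :=
  Measurable.of_comap_le (le_iSup₂_of_le j h le_rfl)

theorem measurable_futureSigma {Ω E : Type*} [MeasurableSpace E] (W : ℤ → Ω → E) {j k : ℤ}
    (h : k ≤ j) : Measurable[futureSigma W k] (W j) :=
  Measurable.of_comap_le (le_iSup₂_of_le j h le_rfl)

theorem abs_measureReal_inter_sub_mul_le_one {Ω : Type*} [MeasurableSpace Ω] (μ : Measure Ω)
    [IsProbabilityMeasure μ] (A B : Set Ω) : |μ.real (A ∩ B) - μ.real A * μ.real B| ≤ 1 := by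
  have h1 : μ.real A * μ.real B ≤ 1 :=
    mul_le_one₀ measureReal_le_one measureReal_nonneg measureReal_le_one
  have h2 : 0 ≤ μ.real A * μ.real B := mul_nonneg measureReal_nonneg measureReal_nonneg
  have h3 : μ.real (A ∩ B) ≤ 1 := measureReal_le_one
  have h4 : 0 ≤ μ.real (A ∩ B) := measureReal_nonneg
  rw [abs_le]
  constructor <;> linarith

theorem abs_measureReal_inter_sub_mul_le_strongMixingCoeff {Ω E : Type*} [MeasurableSpace Ω]
    [MeasurableSpace E] (μ : Measure Ω) [IsProbabilityMeasure μ] (W : ℤ → Ω → E) (i : ℕ) {k : ℤ}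
    {A B : Set Ω} (hA : MeasurableSet[pastSigma W k] A)
    (hB : MeasurableSet[futureSigma W (k + (i : ℤ))] B) :
    |μ.real (A ∩ B) - μ.real A * μ.real B| ≤ strongMixingCoeff μ W i := by
  refine le_csSup ⟨1, ?_⟩ ⟨k, A, B, hA, hB, rfl⟩
  rintro x ⟨k, A, B, -, -, rfl⟩
  exact abs_measureReal_inter_sub_mul_le_one μ A B

theorem strongMixingCoeff_le_one {Ω E : Type*} [MeasurableSpace Ω]
    [MeasurableSpace E] (μ : Measure Ω) [IsProbabilityMeasure μ] (W : ℤ → Ω → E) (i : ℕ) :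
    strongMixingCoeff μ W i ≤ 1 := by
  refine Real.sSup_le ?_ zero_le_one
  rintro x ⟨k, A, B, -, -, rfl⟩
  exact abs_measureReal_inter_sub_mul_le_one μ A B

theorem exists_strongMixingCoeff_le_mul_rpow {Ω E : Type*} [MeasurableSpace Ω]
    [MeasurableSpace E] {μ : Measure Ω} [IsProbabilityMeasure μ] {W : ℤ → Ω → E} {α : ℝ}
    (hα : 0 ≤ α)
    (hmix : (fun i : ℕ => strongMixingCoeff μ W i) =O[atTop] (fun i : ℕ => (i : ℝ) ^ (-α))) :
    ∃ K : ℝ, 0 < K ∧ ∀ k : ℕ, strongMixingCoeff μ W (k + 1) ≤ K * ((k : ℝ) + 1) ^ (-α) := by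
  obtain ⟨c, hc⟩ := hmix.bound
  obtain ⟨N, hN⟩ := eventually_atTop.1 hc
  -- The second summand serves the lags from `N` on; the first serves the finitely many earlier
  -- ones, where the coefficient is at most 1.
  refine ⟨max c ((N : ℝ) + 1) ^ α + max c 1, by positivity, fun k => ?_⟩
  have hk0 : (0 : ℝ) < (k : ℝ) + 1 := by positivity
  have hkα : 0 < ((k : ℝ) + 1) ^ (-α) := Real.rpow_pos_of_pos hk0 _
  rcases le_or_gt N (k + 1) with h | h
  · have h1 := hN (k + 1) h
    push_cast at h1
    rw [Real.norm_eq_abs, Real.norm_of_nonneg hkα.le] at h1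
    refine (le_abs_self _).trans (h1.trans (mul_le_mul_of_nonneg_right ?_ hkα.le))
    have : 0 ≤ max c ((N : ℝ) + 1) ^ α := by positivity
    linarith [le_max_left c 1]
  · refine (strongMixingCoeff_le_one μ W _).trans ?_
    have hkN : (k : ℝ) + 1 ≤ max c ((N : ℝ) + 1) := by
      refine le_max_of_le_right ?_
      have : ((k + 1 : ℕ) : ℝ) ≤ N := by exact_mod_cast h.le
      push_cast at this
      linarith
    have h1 : ((k : ℝ) + 1) ^ α ≤ max c ((N : ℝ) + 1) ^ α := Real.rpow_le_rpow hk0.le hkN hα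
    rw [Real.rpow_neg hk0.le, ← div_eq_mul_inv, one_le_div (Real.rpow_pos_of_pos hk0 _)]
    linarith [le_max_right c 1]

/-- Moment bound for the empirical mean of an instantaneous function of a strictly stationary,
strongly mixing sequence. -/
theorem exists_eLpNorm_empiricalMean_sub_integral_le {Ω E : Type*} [MeasurableSpace Ω]
    [MeasurableSpace E] {μ : Measure Ω} [IsProbabilityMeasure μ] {W : ℤ → Ω → E}
    (hW : ∀ i, Measurable (W i)) (hstat : StrictlyStationary μ W) {g : E → ℝ} (hg : Measurable g)
    {p r α : ℝ} (hp : 2 ≤ p) (hpr : p < r)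
    (hgr : MemLp (fun ω => g (W 0 ω)) (ENNReal.ofReal r) μ) (hα : p / 2 * (r / (r - p)) < α)
    (hmix : (fun i : ℕ => strongMixingCoeff μ W i) =O[atTop] (fun i : ℕ => (i : ℝ) ^ (-α))) :
    ∃ C : ℝ, 0 ≤ C ∧ ∀ n : ℕ, 1 ≤ n →
      eLpNorm (fun ω => empiricalMean (fun i ω => g (W i ω)) n ω - ∫ ω', g (W 1 ω') ∂μ)
        (ENNReal.ofReal p) μ ≤ ENNReal.ofReal (C / √(n : ℝ)) := by
  have hp0 : (0 : ℝ) < p := by linarith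
  have hr0 : 0 < r := by linarith
  have hrp : 0 < r - p := by linarith
  have hα0 : 0 < α := lt_of_le_of_lt (by positivity) hα
  have hid : ∀ i, ProbabilityTheory.IdentDistrib (fun ω => g (W i ω)) (fun ω => g (W 0 ω)) μ μ :=
    fun i => ProbabilityTheory.IdentDistrib.comp
      ⟨(hW i).aemeasurable, (hW 0).aemeasurable, hstat.map_eq hW i⟩ hg
  set m := ∫ ω, g (W 1 ω) ∂μ with hm
  have hid' : ∀ i, ProbabilityTheory.IdentDistrib (fun ω => g (W i ω) - m)
      (fun ω => g (W 0 ω) - m) μ μ := fun i =>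
    (hid i).comp (u := fun x => x - m) (by fun_prop)
  have hgLp : ∀ i, MemLp (fun ω => g (W i ω)) (ENNReal.ofReal r) μ := fun i =>
    (hid i).memLp_iff.2 hgr
  have hXr : ∀ i, MemLp (fun ω => g (W i ω) - m) (ENNReal.ofReal r) μ := fun i =>
    (hgLp i).sub (memLp_const m)
  have hgi : ∀ i, Integrable (fun ω => g (W i ω)) μ := fun i =>
    (hgLp i).integrable (by rw [← ENNReal.ofReal_one]; exact ENNReal.ofReal_le_ofReal (by linarith))
  have hX0 : ∀ i, ∫ ω, (g (W i ω) - m) ∂μ = 0 := fun i => by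
    rw [integral_sub (hgi i) (integrable_const _), hm, (hid i).integral_eq, (hid 1).integral_eq]
    simp
  have hmom : ∀ (s : ℝ) (κ : ℝ) (i : ℤ), ∫ ω, (|g (W i ω) - m| / κ) ^ s ∂μ
      = ∫ ω, (|g (W 0 ω) - m| / κ) ^ s ∂μ := fun s κ i =>
    ((hid' i).comp (u := fun x => (|x| / κ) ^ s) (by fun_prop)).integral_eq
  set I : ℝ → ℝ := fun s => ∫ ω, |g (W 0 ω) - m| ^ s ∂μ with hI
  have hI0 : ∀ s, 0 ≤ I s := fun s => integral_nonneg fun ω => by positivity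
  -- Since `κ ≥ 1`, one has `κ^s ≥ κ ≥ I s` for both `s = p` and `s = r`, so a single scale
  -- normalises both moments.
  set κ := 1 + I p + I r with hκ
  have hκ1 : 1 ≤ κ := by linarith [hI0 p, hI0 r]
  have hκ0 : 0 < κ := by linarith
  have hnorm : ∀ s, 1 ≤ s → I s ≤ κ → ∀ i, ∫ ω, (|g (W i ω) - m| / κ) ^ s ∂μ ≤ 1 := by
    intro s hs hIs i
    rw [hmom]
    simp_rw [Real.div_rpow (abs_nonneg _) hκ0.le]
    rw [integral_div, div_le_one (Real.rpow_pos_of_pos hκ0 _)]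
    exact hIs.trans (Real.self_le_rpow_of_one_le hκ1 hs)
  obtain ⟨K, hK0, hK⟩ := exists_strongMixingCoeff_le_mul_rpow hα0.le hmix
  have hsum : Summable fun k : ℕ => (K * ((k : ℝ) + 1) ^ (-α)) ^ (2 / p - 2 / r) := by
    -- The threshold on `α` is the reciprocal of `2/p - 2/r`.
    have hexp : 1 < α * (2 / p - 2 / r) := by
      have h1 : 2 / p - 2 / r = 2 * (r - p) / (p * r) := by field_simp
      have h2 : p / 2 * (r / (r - p)) * (2 * (r - p) / (p * r)) = 1 := by field_simp
      rw [h1, ← h2]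
      gcongr
    have h := ((summable_nat_add_iff 1).2 (Real.summable_nat_rpow.2 (neg_lt_neg hexp))).mul_left
      (K ^ (2 / p - 2 / r))
    refine h.congr fun k => ?_
    rw [Real.mul_rpow hK0.le (by positivity), ← Real.rpow_mul (by positivity), neg_mul]
    push_cast
    rfl
  -- The index is shifted by one so that `range n` runs over times `1, …, n`.
  obtain ⟨C, hC0, hC⟩ := exists_integral_abs_sum_rpow_le (μ := μ)
    (X := fun i ω => g (W ((i : ℤ) + 1) ω) - m) (ℱ := fun i => pastSigma W ((i : ℤ) + 1))
    (𝒢 := fun i => futureSigma W ((i : ℤ) + 1)) (δ := fun k : ℕ => K * ((k : ℝ) + 1) ^ (-α))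
    hp hpr hκ0 (fun k => by positivity) (fun i => pastSigma_le hW _) (fun i => futureSigma_le hW _)
    (fun i j hij => (hg.comp (measurable_pastSigma W (by omega))).sub_const m)
    (fun i => (hg.comp (measurable_futureSigma W le_rfl)).sub_const m)
    (fun i k A B hA hB => by
      refine (abs_measureReal_inter_sub_mul_le_strongMixingCoeff μ W (k + 1) hA ?_).trans (hK k)
      convert hB using 2
      push_cast
      ring)
    hsum (fun i => hXr _) (fun i => hX0 _) (fun i => hnorm r (by linarith) (by linarith [hI0 p]) _)
    (fun i => hnorm p (by linarith) (by linarith [hI0 r]) _)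
  refine ⟨√C, Real.sqrt_nonneg _, fun n hn => ?_⟩
  have hn0 : (0 : ℝ) < n := by exact_mod_cast hn
  have hmean : (fun ω => empiricalMean (fun i ω => g (W i ω)) n ω - m)
      = (1 / (n : ℝ)) • fun ω => ∑ i ∈ Finset.range n, (g (W ((i : ℤ) + 1) ω) - m) := by
    funext ω
    have hshift : ∑ i ∈ Finset.Icc 1 n, g (W (i : ℤ) ω)
        = ∑ i ∈ Finset.range n, g (W ((i : ℤ) + 1) ω) := by
      rw [← Finset.Ico_add_one_right_eq_Icc, Finset.sum_Ico_eq_sum_range]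
      simp [add_comm]
    simp only [empiricalMean, Pi.smul_apply, smul_eq_mul, hshift, Finset.sum_sub_distrib,
      Finset.sum_const, Finset.card_range, nsmul_eq_mul]
    field_simp
  have hLp : MemLp (fun ω => ∑ i ∈ Finset.range n, (g (W ((i : ℤ) + 1) ω) - m))
      (ENNReal.ofReal p) μ :=
    memLp_finsetSum _ fun i _ => (hXr _).mono_exponent (ENNReal.ofReal_le_ofReal hpr.le)
  have hS : eLpNorm (fun ω => ∑ i ∈ Finset.range n, (g (W ((i : ℤ) + 1) ω) - m))
      (ENNReal.ofReal p) μ ≤ ENNReal.ofReal √(C * n) := by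
    rw [hLp.eLpNorm_eq_integral_rpow_norm (by simpa using hp0) ENNReal.ofReal_ne_top,
      ENNReal.toReal_ofReal hp0.le]
    refine ENNReal.ofReal_le_ofReal ?_
    calc _ ≤ ((C * n) ^ (p / 2)) ^ p⁻¹ :=
          Real.rpow_le_rpow (integral_nonneg fun ω => by positivity) (hC n) (by positivity)
      _ = √(C * n) := by
        rw [← Real.rpow_mul (by positivity), Real.sqrt_eq_rpow]
        congr 1
        field_simp
  rw [hmean, eLpNorm_const_smul]
  calc _ ≤ ENNReal.ofReal (1 / (n : ℝ)) * ENNReal.ofReal √(C * n) := by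
        gcongr
        rw [Real.enorm_eq_ofReal (by positivity)]
    _ = ENNReal.ofReal (√C / √n) := by
      rw [← ENNReal.ofReal_mul (by positivity), Real.sqrt_mul hC0]
      congr 1
      have := Real.sq_sqrt hn0.le
      field_simp
      rw [this, mul_comm]

theorem mainTheorem7 {Ω : Type*} [MeasurableSpace Ω] (μ : Measure Ω) [IsProbabilityMeasure μ]
    (U V : ℤ → Ω → ℝ) (hU : ∀ i, Measurable (U i)) (hV : ∀ i, Measurable (V i))
    (hstat : StrictlyStationary μ (fun i ω => (U i ω, V i ω)))
    (p q r s r' c α : ℝ) (hp : 2 ≤ p) (hpq : p < q)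
    (hr : r = p * q / (q - p)) (hs : s = p * (q + 2) / (q - p)) (hr' : q < r')
    (hUV_r : eLpNorm (fun ω => U 0 ω * V 0 ω) (ENNReal.ofReal r) μ ≤ ENNReal.ofReal c)
    (hV_s : eLpNorm (V 0) (ENNReal.ofReal s) μ ≤ ENNReal.ofReal c)
    (hU_r' : eLpNorm (U 0) (ENNReal.ofReal r') μ ≤ ENNReal.ofReal c)
    (hα : max (p / 2 * (r / (r - p))) (q / 2 * (r' / (r' - q))) < α)
    (hmix : (fun i : ℕ => strongMixingCoeff μ (fun i ω => (U i ω, V i ω)) i)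
      =O[atTop] (fun i : ℕ => (i : ℝ) ^ (-α))) :
    ∃ C : ℝ, ∀ n : ℕ, 1 ≤ n →
      eLpNorm (fun ω => empiricalMean U n ω - ∫ ω', U 1 ω' ∂μ) (ENNReal.ofReal q) μ
          ≤ ENNReal.ofReal (C / √(n : ℝ)) ∧
      eLpNorm (fun ω => empiricalMean (fun i ω => U i ω * V i ω) n ω - ∫ ω', U 1 ω' * V 1 ω' ∂μ)
          (ENNReal.ofReal p) μ
        ≤ ENNReal.ofReal (C / √(n : ℝ)) := by
  have hW : ∀ i, Measurable (fun ω => (U i ω, V i ω)) := fun i => (hU i).prodMk (hV i)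
  have hpq' : 0 < q - p := by linarith
  have hpr : p < r := by
    rw [hr, lt_div_iff₀ hpq']
    nlinarith
  obtain ⟨C₁, hC₁, h₁⟩ := exists_eLpNorm_empiricalMean_sub_integral_le (g := Prod.fst) hW hstat
    measurable_fst (hp.trans hpq.le) hr'
    ⟨(hU 0).aestronglyMeasurable, hU_r'.trans_lt ENNReal.ofReal_lt_top⟩
    ((le_max_right _ _).trans_lt hα) hmix
  obtain ⟨C₂, hC₂, h₂⟩ := exists_eLpNorm_empiricalMean_sub_integral_le (g := fun x => x.1 * x.2)
    hW hstat (by fun_prop) hp hpr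
    ⟨((hU 0).mul (hV 0)).aestronglyMeasurable, hUV_r.trans_lt ENNReal.ofReal_lt_top⟩
    ((le_max_left _ _).trans_lt hα) hmix
  refine ⟨C₁ + C₂, fun n hn => ⟨(h₁ n hn).trans ?_, (h₂ n hn).trans ?_⟩⟩
  · exact ENNReal.ofReal_le_ofReal (by gcongr; linarith)
  · exact ENNReal.ofReal_le_ofReal (by gcongr; linarith)
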